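/- Let $\mathbb{D}=\{z\in\mathbb{C}:|z|<1\}$, let $H^2$ be the space of analytic functions $f$ in $\mathbb{D}$ with $$\|f\|_{H^2}:=\sup_{0<r<1}\left(\int_0^{2\pi}|f(re^{i\theta})|^2\,\frac{d\theta}{2\pi}\right)^{1/2}<\infty,$$ and let $\mu$ be the Möbius invariant measure of $\mathbb{D}$, $d\mu(z)=\frac{1}{(1-|z|^2)^2}\frac{dx\,dy}{\pi}$, $z=x+iy$. There exists a universal constant $C>0$ such that $$\mu\left(\left\{z\in\mathbb{D}:|f(z)|^2(1-|z|^2)>\lambda\right\}\right)\le C\left(\frac1\lambda-1\right)$$ for every $f\in H^2$ with $\|f\|_{H^2}=1$ and every $0<\lambda<1$. -/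

import Mathlib

noncomputable section

namespace HardyDisc

open MeasureTheory

/-- The integral mean `(∫₀^{2π} |f(r e^{iθ})|^p dθ/(2π))^{1/p}`, as an extended nonnegative real. -/
def integralMean (p : ℝ) (f : ℂ → ℂ) (r : ℝ) : ENNReal :=
  ((∫⁻ θ in Set.Ioc 0 (2 * Real.pi), ‖f (circleMap 0 r θ)‖ₑ ^ p) /
    ENNReal.ofReal (2 * Real.pi)) ^ (1 / p)

/-- The Hardy (quasi-)norm of exponent `p`: the supremum of the integral means over `0 < r < 1`,
with the value `∞` allowed. -/
def hardyNorm (p : ℝ) (f : ℂ → ℂ) : ENNReal :=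
  ⨆ r ∈ Set.Ioo (0 : ℝ) 1, integralMean p f r

/-- `f` belongs to `H^p` of the unit disc: it is analytic there and its Hardy norm is finite.
Only the values of `f` in the open unit disc matter. -/
def MemHardy (p : ℝ) (f : ℂ → ℂ) : Prop :=
  DifferentiableOn ℂ f (Metric.ball 0 1) ∧ hardyNorm p f < ⊤

/-- The Möbius invariant measure `dμ(z) = (1 - |z|²)⁻² dx dy / π` of the open unit disc
(as a measure on `ℂ` that vanishes outside the disc). -/
def moebiusMeasure : Measure ℂ :=
  (volume.restrict (Metric.ball (0 : ℂ) 1)).withDensity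
    fun z => ENNReal.ofReal (1 / (Real.pi * (1 - ‖z‖ ^ 2) ^ 2))

/-- The set `E_f(t)` of the points `z` of the unit disc with `|f(z)|² (1 - |z|²) > t`. -/
def superlevelSet (f : ℂ → ℂ) (t : ℝ) : Set ℂ :=
  {z | z ∈ Metric.ball (0 : ℂ) 1 ∧ t < ‖f z‖ ^ 2 * (1 - ‖z‖ ^ 2)}

end HardyDisc

end

/-!
The bound splits into a weak-type estimate, good for `t` away from `1`, and a localization argument
for `t` near `1`.

*Weak type, `μ(E_t) ≤ K / t`.* After a dilation, `f` is continuous up to the circle, and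
`|f(z)| ≤ ∫ P_z |f|` with the Poisson kernel `P_z`. Let `A ⊆ E_t` lie in a smaller disc, let `m(θ)`
be the radial measure of `A` along the ray of angle `θ` and `M = ∫ m`, and weight the points of `A`
by `w = m(θ)^{-1/2}`. On `A` one has `|f| ≥ √t (1 - |z|²)^{-1/2}`, and a bathtub argument along each
ray (`rpow_measure_le_lintegral`) gives `√t M ≤ 3 ∫_A w |f| dμ ≤ 3 ∫ |f| H`, where
`H = ∫_A w P_z dμ(z)`. The square function of `H` is controlled in the manner of Kolmogorov and
Seliverstov: since `∫ P_z P_{z'} ≤ 8 (P_z(z'/|z'|) + P_{z'}(z/|z|))`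
(`lintegral_poissonKernel_mul_le`), expanding the square gives `∫ H² ≤ 16 ∫ √m H`, hence
`∫ H² ≤ 256 M` by Cauchy–Schwarz. Thus `√t M ≲ √M`, that is `M ≲ 1 / t`
(`mul_prod_le_of_le_superposition`, `mul_moebiusMeasure_superlevelSet_le`).

*Near `1`, `μ(E_t) ≤ K (1 - t)`.* If `z, w ∈ E_t`, then `f` nearly attains the reproducing kernel
bound at both points, so the normalized Szegő kernels at `z` and `w` have inner product at least
`2t - 1` in modulus (`mul_norm_le_of_mem_superlevelSet`). Hence the pseudo-hyperbolic distance of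
`z` and `w` is at most `2 √(1 - t)`, and `E_t` lies in a disc of Möbius measure `O(1 - t)`
(`moebiusMeasure_superlevelSet_le_of_near_one`).
-/

noncomputable section

namespace HardyDisc

open MeasureTheory Set Metric Filter Topology
open scoped ENNReal

/-! ### Positive kernels dominated under composition -/

variable {X Θ α : Type*} [MeasurableSpace X] [MeasurableSpace Θ] [MeasurableSpace α]

lemma rpow_half_sq (a : ℝ≥0∞) : (a ^ (1 / 2 : ℝ)) ^ 2 = a := by
  rw [← ENNReal.rpow_natCast, ← ENNReal.rpow_mul]
  norm_num

/-- The Cauchy–Schwarz inequality, squared to avoid fractional powers. -/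
lemma sq_lintegral_mul_le (τ : Measure Θ) {f g : Θ → ℝ≥0∞} (hf : Measurable f)
    (hg : Measurable g) :
    (∫⁻ a, f a * g a ∂τ) ^ 2 ≤ (∫⁻ a, f a ^ 2 ∂τ) * ∫⁻ a, g a ^ 2 ∂τ := by
  have h := ENNReal.lintegral_mul_le_Lp_mul_Lq τ Real.HolderConjugate.two_two
    hf.aemeasurable hg.aemeasurable
  simp only [Pi.mul_apply, ENNReal.rpow_ofNat] at h
  calc _ ≤ _ := pow_le_pow_left' h 2
    _ = _ := by rw [mul_pow, rpow_half_sq, rpow_half_sq]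

/-- Kolmogorov–Seliverstov argument: if the compositions `∫ P x φ P y φ dφ` of a positive kernel are
dominated by the kernel itself, then a superposition `H = ∫ w(x) P x dσ(x)` is bounded in `L²` by
the density `q` of the image of `w σ` under `p`. Expanding `∫ H²` gives `∫ H² ≤ 2 C ∫ q H`, and
Cauchy–Schwarz absorbs `H`; this needs `∫ H² < ∞` beforehand, but not quantitatively. -/
lemma lintegral_sq_superposition_le {σ : Measure X} [SFinite σ] {τ : Measure Θ} [SFinite τ]
    {p : X → Θ} (hp : Measurable p) {P : X → Θ → ℝ≥0∞}
    (hP : Measurable fun x : X × Θ => P x.1 x.2) {C : ℝ≥0∞}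
    (hcomp : ∀ᵐ x ∂σ, ∀ᵐ y ∂σ, ∫⁻ φ, P x φ * P y φ ∂τ ≤ C * (P x (p y) + P y (p x)))
    {w : X → ℝ≥0∞} (hw : Measurable w) {q : Θ → ℝ≥0∞} (hq : Measurable q)
    (hwq : ∀ G : Θ → ℝ≥0∞, Measurable G → ∫⁻ x, w x * G (p x) ∂σ = ∫⁻ θ, q θ * G θ ∂τ)
    (hfin : ∫⁻ φ, (∫⁻ x, w x * P x φ ∂σ) ^ 2 ∂τ ≠ ∞) :
    ∫⁻ φ, (∫⁻ x, w x * P x φ ∂σ) ^ 2 ∂τ ≤ 4 * C ^ 2 * ∫⁻ θ, q θ ^ 2 ∂τ := by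
  have hPx : ∀ x, Measurable (P x) := fun x => hP.comp (measurable_const.prodMk measurable_id)
  have hPφ : ∀ φ, Measurable fun x => P x φ := fun φ =>
    hP.comp (measurable_id.prodMk measurable_const)
  have hwP : Measurable fun x : X × Θ => w x.1 * P x.1 x.2 := (hw.comp measurable_fst).fun_mul hP
  set H : Θ → ℝ≥0∞ := fun φ => ∫⁻ x, w x * P x φ ∂σ with hH
  have hHm : Measurable H := hwP.lintegral_prod_left'
  have hqH : ∫⁻ x, ∫⁻ y, w x * w y * P x (p y) ∂σ ∂σ = ∫⁻ θ, q θ * H θ ∂τ := by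
    calc _ = ∫⁻ x, w x * ∫⁻ θ, q θ * P x θ ∂τ ∂σ := by
          refine lintegral_congr fun x => ?_
          have hPp : Measurable fun y => P x (p y) := (hPx x).comp hp
          rw [← hwq _ (hPx x), ← lintegral_const_mul _ (hw.fun_mul hPp)]
          simp only [mul_assoc]
      _ = ∫⁻ x, ∫⁻ θ, q θ * (w x * P x θ) ∂τ ∂σ := by
          refine lintegral_congr fun x => ?_
          rw [← lintegral_const_mul _ (hq.fun_mul (hPx x))]
          exact lintegral_congr fun θ => by ring
      _ = ∫⁻ θ, ∫⁻ x, q θ * (w x * P x θ) ∂σ ∂τ :=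
          lintegral_lintegral_swap ((hq.comp measurable_snd).fun_mul hwP).aemeasurable
      _ = _ := lintegral_congr fun θ => lintegral_const_mul _ (hw.fun_mul (hPφ θ))
  have hsymm : ∫⁻ x, ∫⁻ y, w x * w y * P y (p x) ∂σ ∂σ = ∫⁻ θ, q θ * H θ ∂τ := by
    rw [← hqH, lintegral_lintegral_swap]
    · refine lintegral_congr fun x => lintegral_congr fun y => by ring
    · exact (((hw.comp measurable_fst).fun_mul (hw.comp measurable_snd)).mul
        (hP.comp (measurable_snd.prodMk (hp.comp measurable_fst)))).aemeasurable
  have hmain : ∫⁻ φ, H φ ^ 2 ∂τ ≤ 2 * C * ∫⁻ θ, q θ * H θ ∂τ := by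
    calc ∫⁻ φ, H φ ^ 2 ∂τ = ∫⁻ φ, ∫⁻ x, w x * P x φ * H φ ∂σ ∂τ := by
          refine lintegral_congr fun φ => ?_
          rw [lintegral_mul_const _ (hw.fun_mul (hPφ φ)), sq]
      _ = ∫⁻ x, ∫⁻ φ, w x * P x φ * H φ ∂τ ∂σ := by
          refine lintegral_lintegral_swap (Measurable.aemeasurable ?_)
          exact (hwP.comp measurable_swap).fun_mul (hHm.comp measurable_fst)
      _ = ∫⁻ x, ∫⁻ y, w x * w y * ∫⁻ φ, P x φ * P y φ ∂τ ∂σ ∂σ := by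
          refine lintegral_congr fun x => ?_
          have : ∀ φ, w x * P x φ * H φ = ∫⁻ y, w x * w y * (P x φ * P y φ) ∂σ := fun φ => by
            change w x * P x φ * ∫⁻ y, w y * P y φ ∂σ = _
            rw [← lintegral_const_mul _ (hw.fun_mul (hPφ φ))]
            exact lintegral_congr fun y => by ring
          simp_rw [this]
          rw [lintegral_lintegral_swap]
          · exact lintegral_congr fun y => lintegral_const_mul _ ((hPx x).fun_mul (hPx y))
          · exact ((measurable_const.fun_mul (hw.comp measurable_snd)).mul
              (((hPx x).comp measurable_fst).fun_mul (hP.comp measurable_swap))).aemeasurable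
      _ ≤ ∫⁻ x, ∫⁻ y, w x * w y * (C * (P x (p y) + P y (p x))) ∂σ ∂σ := by
          refine lintegral_mono_ae (hcomp.mono fun x hx =>
            lintegral_mono_ae (hx.mono fun y hy => ?_))
          gcongr
      _ = C * (∫⁻ x, ∫⁻ y, w x * w y * P x (p y) ∂σ ∂σ
            + ∫⁻ x, ∫⁻ y, w x * w y * P y (p x) ∂σ ∂σ) := by
          have m1 : Measurable fun z : X × X => w z.1 * w z.2 * P z.1 (p z.2) :=
            ((hw.comp measurable_fst).fun_mul (hw.comp measurable_snd)).mul
              (hP.comp (measurable_fst.prodMk (hp.comp measurable_snd)))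
          have m2 : Measurable fun z : X × X => w z.1 * w z.2 * P z.2 (p z.1) :=
            ((hw.comp measurable_fst).fun_mul (hw.comp measurable_snd)).mul
              (hP.comp (measurable_snd.prodMk (hp.comp measurable_fst)))
          rw [← lintegral_add_left m1.lintegral_prod_right',
            ← lintegral_const_mul _ (m1.lintegral_prod_right'.fun_add m2.lintegral_prod_right')]
          refine lintegral_congr fun x => ?_
          have m1x := m1.comp
            (measurable_const.prodMk measurable_id : Measurable fun y : X => (x, y))
          have m2x := m2.comp
            (measurable_const.prodMk measurable_id : Measurable fun y : X => (x, y))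
          simp only [Function.comp_def] at m1x m2x
          rw [← lintegral_add_left m1x, ← lintegral_const_mul _ (m1x.fun_add m2x)]
          exact lintegral_congr fun y => by ring
      _ = _ := by rw [hqH, hsymm]; ring
  set Y := ∫⁻ φ, H φ ^ 2 ∂τ with hY
  rcases eq_or_ne Y 0 with h0 | h0
  · rw [h0]; exact zero_le
  -- Squaring the bound `Y ≤ 2 C ∫ q H` and applying Cauchy–Schwarz, one factor `Y` cancels.
  have hcs := sq_lintegral_mul_le τ hq hHm
  have : Y * Y ≤ (4 * C ^ 2 * ∫⁻ θ, q θ ^ 2 ∂τ) * Y := by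
    calc Y * Y = Y ^ 2 := (sq Y).symm
      _ ≤ (2 * C * ∫⁻ θ, q θ * H θ ∂τ) ^ 2 := pow_le_pow_left' hmain 2
      _ = 4 * C ^ 2 * (∫⁻ θ, q θ * H θ ∂τ) ^ 2 := by ring
      _ ≤ 4 * C ^ 2 * ((∫⁻ θ, q θ ^ 2 ∂τ) * Y) := by gcongr
      _ = _ := by ring
  exact (ENNReal.mul_le_mul_iff_left h0 hfin).1 this

/-- Bathtub estimate: if the sublevel sets of `g` have measure at most `a²`, then the set of a given
measure `m` on which `∫ g` is least still has integral of order `m^{3/2}`. At the level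
`a = (2/3) √m` the sublevel set takes up at most `4/9` of the mass. -/
lemma rpow_measure_le_lintegral {ν : Measure X} {g : X → ℝ≥0∞} (hg : Measurable g)
    (hν : ∀ a : ℝ≥0∞, ν {r | g r < a} ≤ a ^ 2) {S : Set X} (hS : ν S ≠ ∞) :
    (ν S ^ (1 / 2 : ℝ)) ^ 3 ≤ 3 * ∫⁻ r in S, g r ∂ν := by
  set q := ν S ^ (1 / 2 : ℝ) with hq
  have hq2 : q ^ 2 = ν S := rpow_half_sq _
  set a : ℝ≥0∞ := (2 / 3 : ℝ≥0∞) * q with ha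
  have hsplit : ν S ≤ ν (S ∩ {r | a ≤ g r}) + a ^ 2 := by
    calc ν S ≤ ν ((S ∩ {r | a ≤ g r}) ∪ {r | g r < a}) := measure_mono fun r hr => by
          by_cases h : a ≤ g r
          · exact Or.inl ⟨hr, h⟩
          · exact Or.inr (not_le.1 h)
      _ ≤ _ := (measure_union_le _ _).trans (by gcongr; exact hν a)
  have hmarkov : a * ν (S ∩ {r | a ≤ g r}) ≤ ∫⁻ r in S, g r ∂ν := by
    have h := mul_meas_ge_le_lintegral (μ := ν.restrict S) hg a
    rwa [Measure.restrict_apply (measurableSet_le measurable_const hg), inter_comm] at h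
  have hqt : q ≠ ∞ := ENNReal.rpow_ne_top_of_nonneg (by norm_num) hS
  have hmt : ν (S ∩ {r | a ≤ g r}) ≠ ∞ := ne_top_of_le_ne_top hS (measure_mono inter_subset_left)
  refine le_trans ?_ (mul_le_mul_right hmarkov 3)
  rw [← hq2] at hsplit
  have h23 : (2 / 3 : ℝ≥0∞) = ENNReal.ofReal (2 / 3) := by
    rw [ENNReal.ofReal_div_of_pos (by norm_num)]; norm_num
  lift q to NNReal using hqt with q'
  lift ν (S ∩ {r | a ≤ g r}) to NNReal using hmt with m
  rw [ha, h23] at *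
  rw [ENNReal.ofReal] at *
  have h1 : q' ^ 2 ≤ m + ((2 / 3 : ℝ).toNNReal * q') ^ 2 := by exact_mod_cast hsplit
  have h2 : q' ^ 3 ≤ 3 * ((2 / 3 : ℝ).toNNReal * q' * m) := by
    rw [← NNReal.coe_le_coe] at h1 ⊢
    push_cast at h1 ⊢
    rw [Real.coe_toNNReal _ (by norm_num)] at h1 ⊢
    nlinarith [mul_le_mul_of_nonneg_left h1 q'.2, pow_nonneg q'.2 3, q'.coe_nonneg]
  exact_mod_cast h2

/-- Weak-type estimate for a positive kernel `P` on `(α × Θ) × Θ` dominated under composition: the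
set `A` where `∫ P x φ F φ dφ ≥ s g` has measure `≲ s⁻² ∫ F²`. No constant depends on the bound `B`
or on the total masses, which only make the quantities finite. The points of `A` are weighted by
`w = (ν A_θ)^{-1/2}`. -/
lemma mul_prod_le_of_le_superposition {ν : Measure α} [IsFiniteMeasure ν] {τ : Measure Θ}
    [IsFiniteMeasure τ] {P : α × Θ → Θ → ℝ≥0∞} (hP : Measurable fun x : (α × Θ) × Θ => P x.1 x.2)
    {A : Set (α × Θ)} (hA : MeasurableSet A) {B C : ℝ≥0∞} (hB : B ≠ ∞)
    (hPB : ∀ x ∈ A, ∀ φ, P x φ ≤ B)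
    (hcomp : ∀ x ∈ A, ∀ y ∈ A, ∫⁻ φ, P x φ * P y φ ∂τ ≤ C * (P x y.2 + P y x.2))
    {g : α → ℝ≥0∞} (hg : Measurable g) (hν : ∀ a : ℝ≥0∞, ν {r | g r < a} ≤ a ^ 2)
    {F : Θ → ℝ≥0∞} (hF : Measurable F) {s : ℝ≥0∞}
    (hAF : ∀ x ∈ A, s * g x.1 ≤ ∫⁻ φ, P x φ * F φ ∂τ) :
    s ^ 2 * ∫⁻ θ, ν {r | (r, θ) ∈ A} ∂τ ≤ 36 * C ^ 2 * ∫⁻ φ, F φ ^ 2 ∂τ := by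
  set m : Θ → ℝ≥0∞ := fun θ => ν {r | (r, θ) ∈ A} with hm
  have hmm : Measurable m := measurable_measure_prodMk_right hA
  have hmt : ∀ θ, m θ ≠ ∞ := fun θ => measure_ne_top _ _
  set q : Θ → ℝ≥0∞ := fun θ => m θ ^ (1 / 2 : ℝ) with hq
  have hqm : Measurable q := hmm.pow_const _
  have hq2 : ∀ θ, q θ ^ 2 = m θ := fun θ => rpow_half_sq _
  have hqt : ∀ θ, q θ ≠ ∞ := fun θ => ENNReal.rpow_ne_top_of_nonneg (by norm_num) (hmt θ)
  -- This holds for `q θ = 0` too, as `∞ * 0 = 0`.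
  have hqinv : ∀ θ, (q θ)⁻¹ * q θ ^ 2 = q θ := fun θ => by
    rcases eq_or_ne (q θ) 0 with h | h
    · simp [h]
    · rw [sq, ← mul_assoc, ENNReal.inv_mul_cancel h (hqt θ), one_mul]
  set σ : Measure (α × Θ) := (ν.prod τ).restrict A with hσ
  have hslice : ∀ θ, MeasurableSet {r | (r, θ) ∈ A} := fun θ =>
    (measurable_id.prodMk measurable_const) hA
  have hiter : ∀ h : α × Θ → ℝ≥0∞, Measurable h →
      ∫⁻ x, h x ∂σ = ∫⁻ θ, ∫⁻ r in {r | (r, θ) ∈ A}, h (r, θ) ∂ν ∂τ := fun h hh => by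
    rw [hσ, ← lintegral_indicator hA, lintegral_prod_symm' _ (hh.indicator hA)]
    refine lintegral_congr fun θ => ?_
    rw [← lintegral_indicator (hslice θ)]
    rfl
  set w : α × Θ → ℝ≥0∞ := fun x => (q x.2)⁻¹ with hw
  have hwm : Measurable w := (hqm.comp measurable_snd).inv
  have hwq : ∀ G : Θ → ℝ≥0∞, Measurable G →
      ∫⁻ x, w x * G x.2 ∂σ = ∫⁻ θ, q θ * G θ ∂τ := fun G hG => by
    have hGs : Measurable fun x : α × Θ => G x.2 := hG.comp measurable_snd
    rw [hiter _ (hwm.fun_mul hGs)]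
    refine lintegral_congr fun θ => ?_
    change ∫⁻ _ in {r | (r, θ) ∈ A}, (q θ)⁻¹ * G θ ∂ν = _
    rw [setLIntegral_const]
    change (q θ)⁻¹ * G θ * m θ = _
    rw [← hq2, mul_right_comm, hqinv]
  have hPx : ∀ x, Measurable (P x) := fun x => hP.comp (measurable_const.prodMk measurable_id)
  have hPφ : ∀ φ, Measurable fun x => P x φ := fun φ =>
    hP.comp (measurable_id.prodMk measurable_const)
  have hwP : Measurable fun x : (α × Θ) × Θ => w x.1 * P x.1 x.2 :=
    (hwm.comp measurable_fst).fun_mul hP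
  set H : Θ → ℝ≥0∞ := fun φ => ∫⁻ x, w x * P x φ ∂σ with hH
  have hHm : Measurable H := hwP.lintegral_prod_left'
  have hqle : ∀ θ, q θ ≤ ν univ ^ (1 / 2 : ℝ) := fun θ =>
    ENNReal.rpow_le_rpow (measure_mono (subset_univ _)) (by norm_num)
  have hqu : ν univ ^ (1 / 2 : ℝ) ≠ ∞ :=
    ENNReal.rpow_ne_top_of_nonneg (by norm_num) (measure_ne_top _ _)
  have hHB : ∀ φ, H φ ≤ ν univ ^ (1 / 2 : ℝ) * B * τ univ := fun φ => by
    calc H φ ≤ ∫⁻ x, w x * B ∂σ :=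
          setLIntegral_mono' hA fun x hx => by gcongr; exact hPB x hx φ
      _ = ∫⁻ θ, q θ * B ∂τ := hwq (fun _ => B) measurable_const
      _ ≤ ∫⁻ _, ν univ ^ (1 / 2 : ℝ) * B ∂τ := lintegral_mono fun θ => by gcongr; exact hqle θ
      _ = _ := lintegral_const _
  have hfin : ∫⁻ φ, H φ ^ 2 ∂τ ≠ ∞ := by
    refine ne_top_of_le_ne_top ?_ (lintegral_mono fun φ => pow_le_pow_left' (hHB φ) 2)
    rw [lintegral_const]
    exact ENNReal.mul_ne_top (ENNReal.pow_ne_top (ENNReal.mul_ne_top (ENNReal.mul_ne_top hqu hB)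
      (measure_ne_top _ _))) (measure_ne_top _ _)
  have hH2 : ∫⁻ φ, H φ ^ 2 ∂τ ≤ 4 * C ^ 2 * ∫⁻ θ, m θ ∂τ := by
    have := lintegral_sq_superposition_le (σ := σ) (τ := τ) measurable_snd hP (C := C)
      ((ae_restrict_iff' hA).2 (.of_forall fun x hx => (ae_restrict_iff' hA).2
        (.of_forall fun y hy => hcomp x hx y hy))) hwm hqm hwq hfin
    simpa only [hq2] using this
  set M := ∫⁻ θ, m θ ∂τ with hM
  have hMt : M ≠ ∞ := by
    refine ne_top_of_le_ne_top ?_ (lintegral_mono fun θ => measure_mono (subset_univ _))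
    rw [lintegral_const]
    exact ENNReal.mul_ne_top (measure_ne_top _ _) (measure_ne_top _ _)
  -- Lower bound from the bathtub estimate on each slice, upper bound by duality.
  have hlow : s * M ≤ 3 * ∫⁻ φ, F φ * H φ ∂τ := by
    calc s * M = ∫⁻ θ, s * m θ ∂τ := (lintegral_const_mul _ hmm).symm
      _ ≤ ∫⁻ θ, 3 * ∫⁻ r in {r | (r, θ) ∈ A}, w (r, θ) * (s * g r) ∂ν ∂τ := by
          refine lintegral_mono fun θ => ?_
          have hb := rpow_measure_le_lintegral hg hν (hmt θ)
          calc s * m θ = s * ((q θ)⁻¹ * q θ ^ 3) := by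
                rw [pow_succ, ← mul_assoc (q θ)⁻¹, hqinv, ← sq, hq2]
            _ ≤ s * ((q θ)⁻¹ * (3 * ∫⁻ r in {r | (r, θ) ∈ A}, g r ∂ν)) := by gcongr
            _ = 3 * ((q θ)⁻¹ * (s * ∫⁻ r in {r | (r, θ) ∈ A}, g r ∂ν)) := by ring
            _ = _ := by
                rw [← lintegral_const_mul _ hg, ← lintegral_const_mul _ (hg.const_mul s)]
      _ = 3 * ∫⁻ x, w x * (s * g x.1) ∂σ := by
          have hmeas : Measurable fun x : α × Θ => w x * (s * g x.1) :=
            hwm.fun_mul ((hg.comp measurable_fst).const_mul s)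
          rw [hiter _ hmeas, lintegral_const_mul']
          norm_num
      _ ≤ 3 * ∫⁻ x, w x * ∫⁻ φ, P x φ * F φ ∂τ ∂σ := by
          gcongr 3 * ?_
          exact setLIntegral_mono' hA fun x hx => by gcongr; exact hAF x hx
      _ = 3 * ∫⁻ x, ∫⁻ φ, F φ * (w x * P x φ) ∂τ ∂σ := by
          congr 1
          refine lintegral_congr fun x => ?_
          rw [← lintegral_const_mul _ ((hPx x).fun_mul hF)]
          exact lintegral_congr fun φ => by ring
      _ = 3 * ∫⁻ φ, F φ * H φ ∂τ := by
          rw [lintegral_lintegral_swap ((hF.comp measurable_snd).fun_mul hwP).aemeasurable]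
          congr 1
          exact lintegral_congr fun φ => lintegral_const_mul _ (hwm.fun_mul (hPφ φ))
  rcases eq_or_ne M 0 with h0 | h0
  · rw [h0]; simp
  refine (ENNReal.mul_le_mul_iff_left h0 hMt).1 ?_
  calc s ^ 2 * M * M = (s * M) ^ 2 := by ring
    _ ≤ (3 * ∫⁻ φ, F φ * H φ ∂τ) ^ 2 := pow_le_pow_left' hlow 2
    _ = 9 * (∫⁻ φ, F φ * H φ ∂τ) ^ 2 := by ring
    _ ≤ 9 * ((∫⁻ φ, F φ ^ 2 ∂τ) * (4 * C ^ 2 * M)) := by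
        gcongr
        exact (sq_lintegral_mul_le τ hF hHm).trans (by gcongr)
    _ = _ := by ring

/-! ### The Poisson kernel of the unit disc -/

/-- Normalized arc length `dθ / (2π)` on the parameter interval `(0, 2π]` of the unit circle. -/
def arcMeasure : Measure ℝ :=
  (ENNReal.ofReal (2 * Real.pi))⁻¹ • volume.restrict (Ioc 0 (2 * Real.pi))

lemma ofReal_two_pi_ne_zero : ENNReal.ofReal (2 * Real.pi) ≠ 0 := by
  simp [Real.pi_pos]

instance : IsFiniteMeasure arcMeasure := by
  unfold arcMeasure
  exact Measure.smul_finite _ (ENNReal.inv_ne_top.2 ofReal_two_pi_ne_zero)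

lemma circleAverage_eq_integral_arcMeasure {E : Type*} [NormedAddCommGroup E] [NormedSpace ℝ E]
    (f : ℂ → E) (c : ℂ) (R : ℝ) :
    Real.circleAverage f c R = ∫ θ, f (circleMap c R θ) ∂arcMeasure := by
  rw [Real.circleAverage, arcMeasure, integral_smul_measure,
    intervalIntegral.integral_of_le Real.two_pi_pos.le, ENNReal.toReal_inv,
    ENNReal.toReal_ofReal Real.two_pi_pos.le]

lemma lintegral_arcMeasure (f : ℝ → ℝ≥0∞) :
    ∫⁻ θ, f θ ∂arcMeasure = (∫⁻ θ in Ioc 0 (2 * Real.pi), f θ) / ENNReal.ofReal (2 * Real.pi) := by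
  rw [arcMeasure, lintegral_smul_measure, smul_eq_mul, mul_comm, div_eq_mul_inv]

lemma continuous_comp_circleMap {f : ℂ → ℂ} (hf : DiffContOnCl ℂ f (ball 0 1)) :
    Continuous fun θ => f (circleMap 0 1 θ) := by
  refine hf.continuousOn.comp_continuous (continuous_circleMap 0 1) fun θ => ?_
  rw [closure_ball _ one_ne_zero]
  exact circleMap_mem_closedBall _ zero_le_one _

lemma poissonKernel_circleMap_nonneg {z : ℂ} (hz : ‖z‖ < 1) (φ : ℝ) :
    0 ≤ poissonKernel 0 z (circleMap 0 1 φ) := by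
  rw [poissonKernel_def]
  have : ‖circleMap 0 1 φ - 0‖ = 1 := by simp
  rw [this, sub_zero]
  have := norm_nonneg z
  exact div_nonneg (by nlinarith) (sq_nonneg _)

lemma enorm_le_lintegral_poissonKernel {f : ℂ → ℂ} (hf : DiffContOnCl ℂ f (ball 0 1)) {z : ℂ}
    (hz : ‖z‖ < 1) :
    ‖f z‖ₑ ≤ ∫⁻ φ, ENNReal.ofReal (poissonKernel 0 z (circleMap 0 1 φ)) *
      ‖f (circleMap 0 1 φ)‖ₑ ∂arcMeasure := by
  have h := hf.circleAverage_poissonKernel_smul (w := z) (by simpa using hz)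
  rw [circleAverage_eq_integral_arcMeasure] at h
  calc ‖f z‖ₑ = _ := by rw [← h]
    _ ≤ _ := enorm_integral_le_lintegral_enorm _
    _ = _ := by
      refine lintegral_congr fun φ => ?_
      simp only [Pi.smul_apply']
      rw [enorm_smul, Real.enorm_eq_ofReal (poissonKernel_circleMap_nonneg hz φ)]

lemma one_sub_conj_mul_ne_zero {z w : ℂ} (hz : ‖z‖ < 1) (hw : ‖w‖ ≤ 1) :
    1 - (starRingEnd ℂ) z * w ≠ 0 := by
  intro h
  have h1 : ‖(starRingEnd ℂ) z * w‖ = 1 := by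
    rw [← sub_eq_zero.1 h, norm_one]
  rw [norm_mul, RCLike.norm_conj] at h1
  have := norm_nonneg z
  have := norm_nonneg w
  nlinarith

/-- On the unit circle the Poisson kernel is the real part of a function that is analytic in the
integration variable, so that the Poisson formula can be applied to it. -/
lemma poissonKernel_eq_re {z ζ : ℂ} (hζ : ‖ζ‖ = 1) :
    poissonKernel 0 z ζ = ((1 + (starRingEnd ℂ) z * ζ) / (1 - (starRingEnd ℂ) z * ζ)).re := by
  have hζ2 : ζ * (starRingEnd ℂ) ζ = 1 := by
    rw [Complex.mul_conj, Complex.normSq_eq_norm_sq, hζ]; simp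
  have hζ0 : (starRingEnd ℂ) ζ ≠ 0 := right_ne_zero_of_mul_eq_one hζ2
  rw [poissonKernel_eq_re_herglotzRieszKernel, Function.comp_apply, herglotzRieszKernel_def,
    ← Complex.conj_re]
  congr 1
  simp only [map_div₀, map_add, map_sub, sub_zero]
  rw [← mul_div_mul_left _ _ (right_ne_zero_of_mul_eq_one ((mul_comm _ _).trans hζ2))]
  congr 1 <;> linear_combination hζ2

/-- Semigroup property of the Poisson kernel. -/
lemma lintegral_poissonKernel_mul {z w : ℂ} (hz : ‖z‖ < 1) (hw : ‖w‖ < 1) :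
    ∫⁻ φ, ENNReal.ofReal (poissonKernel 0 z (circleMap 0 1 φ)) *
        ENNReal.ofReal (poissonKernel 0 w (circleMap 0 1 φ)) ∂arcMeasure =
      ENNReal.ofReal ((1 - ‖z‖ ^ 2 * ‖w‖ ^ 2) / ‖1 - (starRingEnd ℂ) z * w‖ ^ 2) := by
  set g : ℂ → ℂ := fun u => (1 + (starRingEnd ℂ) z * u) / (1 - (starRingEnd ℂ) z * u) with hg
  have hgd : DiffContOnCl ℂ g (ball 0 1) := by
    apply DifferentiableOn.diffContOnCl
    rw [closure_ball _ one_ne_zero]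
    intro u hu
    have := one_sub_conj_mul_ne_zero hz (mem_closedBall_zero_iff.1 hu)
    apply DifferentiableAt.differentiableWithinAt
    fun_prop (disch := assumption)
  have hwc : w ∈ ball (0 : ℂ) 1 := by simpa using hw
  have h := hgd.circleAverage_poissonKernel_smul hwc
  rw [circleAverage_eq_integral_arcMeasure] at h
  have hPc : ∀ {u : ℂ}, ‖u‖ < 1 → Continuous fun φ => poissonKernel 0 u (circleMap 0 1 φ) :=
    fun {u} hu => by
      simp only [poissonKernel_def]
      refine Continuous.div (by fun_prop) (by fun_prop) fun φ => ?_
      have h1 : ‖circleMap 0 1 φ‖ = 1 := by simp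
      rw [sub_zero, sub_zero]
      intro h0
      have : circleMap 0 1 φ = u := by simpa [sub_eq_zero] using h0
      rw [this] at h1
      linarith
  have hgc := continuous_comp_circleMap hgd
  have hint : ∀ {E : Type} [NormedAddCommGroup E] {k : ℝ → E}, Continuous k →
      Integrable k arcMeasure := fun {E} _ {k} hk =>
    (hk.integrableOn_Ioc).smul_measure (ENNReal.inv_ne_top.2 ofReal_two_pi_ne_zero)
  have hre : ∫ φ, poissonKernel 0 z (circleMap 0 1 φ) * poissonKernel 0 w (circleMap 0 1 φ)
      ∂arcMeasure = (g w).re := by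
    rw [← h]
    have hi : Integrable (fun φ => (poissonKernel 0 w • g) (circleMap 0 1 φ)) arcMeasure :=
      hint ((hPc hw).smul hgc)
    refine Eq.trans ?_ (Complex.reCLM.integral_comp_comm hi)
    refine integral_congr_ae (.of_forall fun φ => ?_)
    simp only [Pi.smul_apply', Complex.real_smul, Complex.reCLM_apply, Complex.re_ofReal_mul]
    rw [poissonKernel_eq_re (z := z) (ζ := circleMap 0 1 φ) (by simp), mul_comm]
  have hgw : (g w).re = (1 - ‖z‖ ^ 2 * ‖w‖ ^ 2) / ‖1 - (starRingEnd ℂ) z * w‖ ^ 2 := by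
    have hn : ‖z‖ ^ 2 * ‖w‖ ^ 2 = Complex.normSq ((starRingEnd ℂ) z * w) := by
      rw [map_mul, Complex.normSq_conj, Complex.normSq_eq_norm_sq, Complex.normSq_eq_norm_sq]
    have hre_div : ∀ a : ℂ, ((1 + a) / (1 - a)).re
        = (1 - Complex.normSq a) / Complex.normSq (1 - a) := fun a => by
      simp only [Complex.div_re, Complex.normSq_apply, Complex.add_re, Complex.sub_re,
        Complex.add_im, Complex.sub_im, Complex.one_re, Complex.one_im]
      rw [← add_div]
      congr 1
      ring
    rw [hn, ← Complex.normSq_eq_norm_sq]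
    exact hre_div _
  rw [← hgw, ← hre, ofReal_integral_eq_lintegral_ofReal]
  · refine lintegral_congr fun φ => ?_
    rw [ENNReal.ofReal_mul (poissonKernel_circleMap_nonneg hz φ)]
  · exact hint ((hPc hz).mul (hPc hw))
  · exact .of_forall fun φ => mul_nonneg (poissonKernel_circleMap_nonneg hz φ)
      (poissonKernel_circleMap_nonneg hw φ)

lemma div_norm_sq_le_poissonKernel {r s : ℝ} (hr : 0 ≤ r) (hs : 0 ≤ s) (hrs : r ≤ s) (hs1 : s < 1)
    (θ φ : ℝ) :
    (1 - r ^ 2 * s ^ 2) / ‖1 - (starRingEnd ℂ) (circleMap 0 r θ) * circleMap 0 s φ‖ ^ 2 ≤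
      8 * poissonKernel 0 (circleMap 0 r θ) (circleMap 0 1 φ) := by
  set z := circleMap 0 r θ with hz
  set ζ := circleMap 0 1 φ with hζ
  have hzn : ‖z‖ = r := by simp [hz, abs_of_nonneg hr]
  have hζn : ‖ζ‖ = 1 := by simp [hζ]
  have hw : circleMap 0 s φ = s * ζ := by simp [hζ, circleMap]
  rw [hw, poissonKernel_def, sub_zero, sub_zero, hzn, hζn]
  have hζ2 : (starRingEnd ℂ) ζ * ζ = 1 := by
    rw [mul_comm, Complex.mul_conj, Complex.normSq_eq_norm_sq, hζn]; simp
  have h1 : ‖ζ - z‖ = ‖1 - (starRingEnd ℂ) z * ζ‖ := by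
    rw [← RCLike.norm_conj (ζ - z), ← mul_one ‖(starRingEnd ℂ) (ζ - z)‖, ← hζn, ← norm_mul,
      map_sub, sub_mul, hζ2]
  rw [h1]
  set a := (starRingEnd ℂ) z * ζ with ha
  have han : ‖a‖ = r := by rw [ha, norm_mul, RCLike.norm_conj, hzn, hζn, mul_one]
  have hsa : (starRingEnd ℂ) z * (s * ζ) = s * a := by rw [ha]; ring
  rw [hsa]
  have hlow : 1 - r * s ≤ ‖1 - s * a‖ := by
    have := norm_sub_norm_le (1 : ℂ) (s * a)
    rw [norm_one, norm_mul, han, Complex.norm_real, Real.norm_of_nonneg hs] at this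
    linarith
  have hup : ‖1 - a‖ ≤ ‖1 - s * a‖ + (1 - s) * r := by
    calc ‖1 - a‖ = ‖(1 - s * a) + ((s - 1 : ℝ) : ℂ) * a‖ := by congr 1; push_cast; ring
      _ ≤ _ := norm_add_le _ _
      _ = _ := by
        rw [norm_mul, Complex.norm_real, han, Real.norm_of_nonpos (by linarith), neg_sub]
  have hpos : 0 < 1 - r * s := by nlinarith
  have hpos' : 0 < ‖1 - a‖ := by
    have := norm_sub_norm_le (1 : ℂ) a
    rw [norm_one, han] at this
    linarith
  have hpos'' : 0 < ‖1 - s * a‖ := hpos.trans_le hlow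
  have h2 : ‖1 - a‖ ≤ 2 * ‖1 - s * a‖ := by nlinarith
  rw [← mul_div_assoc, div_le_div_iff₀ (by positivity) (by positivity)]
  have h3 : ‖1 - a‖ ^ 2 ≤ 4 * ‖1 - s * a‖ ^ 2 := by nlinarith [norm_nonneg (1 - s * a)]
  have h4 : 1 - r ^ 2 * s ^ 2 ≤ 2 * (1 ^ 2 - r ^ 2) := by
    have : r ^ 2 ≤ s ^ 2 := by gcongr
    nlinarith [sq_nonneg (r ^ 2 - 1), mul_le_mul_of_nonneg_left this (sq_nonneg r)]
  have h5 : 0 ≤ 1 ^ 2 - r ^ 2 := by nlinarith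
  calc _ ≤ 2 * (1 ^ 2 - r ^ 2) * (4 * ‖1 - s * a‖ ^ 2) := by gcongr
    _ = _ := by ring

lemma lintegral_poissonKernel_mul_le {r s : ℝ} (hr : 0 ≤ r) (hr1 : r < 1) (hs : 0 ≤ s)
    (hs1 : s < 1) (θ φ : ℝ) :
    ∫⁻ t, ENNReal.ofReal (poissonKernel 0 (circleMap 0 r θ) (circleMap 0 1 t)) *
        ENNReal.ofReal (poissonKernel 0 (circleMap 0 s φ) (circleMap 0 1 t)) ∂arcMeasure ≤
      8 * (ENNReal.ofReal (poissonKernel 0 (circleMap 0 r θ) (circleMap 0 1 φ)) +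
        ENNReal.ofReal (poissonKernel 0 (circleMap 0 s φ) (circleMap 0 1 θ))) := by
  have key : ∀ {r s : ℝ}, 0 ≤ r → 0 ≤ s → r ≤ s → s < 1 → ∀ θ φ : ℝ,
      ∫⁻ t, ENNReal.ofReal (poissonKernel 0 (circleMap 0 r θ) (circleMap 0 1 t)) *
        ENNReal.ofReal (poissonKernel 0 (circleMap 0 s φ) (circleMap 0 1 t)) ∂arcMeasure ≤
      8 * ENNReal.ofReal (poissonKernel 0 (circleMap 0 r θ) (circleMap 0 1 φ)) := by
    intro r s hr hs hrs hs1 θ φ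
    rw [lintegral_poissonKernel_mul (by simpa [abs_of_nonneg hr] using hrs.trans_lt hs1)
      (by simpa [abs_of_nonneg hs] using hs1)]
    have h := ENNReal.ofReal_le_ofReal (div_norm_sq_le_poissonKernel hr hs hrs hs1 θ φ)
    rw [ENNReal.ofReal_mul (by norm_num), ENNReal.ofReal_ofNat] at h
    simpa [abs_of_nonneg hr, abs_of_nonneg hs] using h
  rcases le_total r s with h | h
  · exact (key hr hs h hs1 θ φ).trans (by gcongr; exact le_self_add)
  · simp_rw [mul_comm (ENNReal.ofReal (poissonKernel 0 (circleMap 0 r θ) _))]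
    exact (key hs hr h hr1 φ θ).trans (by gcongr; exact le_add_self)

/-! ### Polar coordinates and the weak-type estimate up to the boundary -/

/-- The radial part `2r dr / (1 - r²)²` of the Möbius invariant measure, cut off at radius `R`. -/
def radialMeasure (R : ℝ) : Measure ℝ :=
  (volume.restrict (Ioo 0 R)).withDensity fun r => ENNReal.ofReal (2 * r / (1 - r ^ 2) ^ 2)

/-- An antiderivative of the density is `(1 - r²)⁻¹`. -/
lemma lintegral_radial_density_le {ρ : ℝ} (hρ : ρ < 1) :
    ∫⁻ r in Ioo 0 ρ, ENNReal.ofReal (2 * r / (1 - r ^ 2) ^ 2) ≤ ENNReal.ofReal (1 - ρ ^ 2)⁻¹ := by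
  rcases le_or_gt ρ 0 with h0 | h0
  · simp [Ioo_eq_empty_of_le h0]
  have hne : ∀ r ∈ uIcc 0 ρ, 1 - r ^ 2 ≠ 0 := fun r hr => by
    rw [uIcc_of_le h0.le] at hr
    nlinarith [hr.1, hr.2]
  have hc : ContinuousOn (fun r : ℝ => 2 * r / (1 - r ^ 2) ^ 2) (uIcc 0 ρ) := by
    refine ContinuousOn.div (by fun_prop) (by fun_prop) fun r hr => pow_ne_zero 2 (hne r hr)
  have hd : ∀ r ∈ uIcc 0 ρ,
      HasDerivAt (fun r : ℝ => (1 - r ^ 2)⁻¹) (2 * r / (1 - r ^ 2) ^ 2) r := fun r hr => by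
    have h1 : HasDerivAt (fun r : ℝ => 1 - r ^ 2) (-(2 * r)) r := by
      simpa using (hasDerivAt_pow 2 r).const_sub 1
    simpa using h1.fun_inv (hne r hr)
  have hint := hc.intervalIntegrable (μ := volume)
  have h := intervalIntegral.integral_eq_sub_of_hasDerivAt hd hint
  rw [intervalIntegral.integral_of_le h0.le, integral_Ioc_eq_integral_Ioo] at h
  rw [← ofReal_integral_eq_lintegral_ofReal, h]
  · exact ENNReal.ofReal_le_ofReal (by norm_num)
  · exact ((intervalIntegrable_iff_integrableOn_Ioo_of_le h0.le).1 hint)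
  · refine (ae_restrict_iff' measurableSet_Ioo).2 (.of_forall fun r hr => ?_)
    have := hr.1
    change 0 ≤ 2 * r / (1 - r ^ 2) ^ 2
    positivity

lemma isFiniteMeasure_radialMeasure {R : ℝ} (hR : R < 1) : IsFiniteMeasure (radialMeasure R) := by
  refine ⟨?_⟩
  rw [radialMeasure, withDensity_apply _ MeasurableSet.univ, Measure.restrict_univ]
  exact (lintegral_radial_density_le hR).trans_lt ENNReal.ofReal_lt_top

/-- The hypothesis of the bathtub estimate for `g(r) = (1 - r²)^{-1/2}`. -/
lemma radialMeasure_inv_sqrt_lt_le {R : ℝ} (hR : R ≤ 1) (a : ℝ≥0∞) :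
    radialMeasure R {r | ENNReal.ofReal (√(1 - r ^ 2))⁻¹ < a} ≤ a ^ 2 := by
  rcases eq_or_ne a ∞ with rfl | ha
  · simp
  lift a to NNReal using ha
  have hm : MeasurableSet {r : ℝ | ENNReal.ofReal (√(1 - r ^ 2))⁻¹ < a} :=
    measurableSet_lt (by fun_prop) measurable_const
  rw [radialMeasure, withDensity_apply _ hm, Measure.restrict_restrict hm]
  have hsub : {r : ℝ | ENNReal.ofReal (√(1 - r ^ 2))⁻¹ < a} ∩ Ioo 0 R ⊆
      Ioo 0 (√(1 - ((a : ℝ) ^ 2)⁻¹)) := by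
    rintro r ⟨hr, hr0, hr1⟩
    have hpos : 0 < 1 - r ^ 2 := by nlinarith
    have h1 : (√(1 - r ^ 2))⁻¹ < a := by
      have hr' : ENNReal.ofReal (√(1 - r ^ 2))⁻¹ < (a : ℝ≥0∞) := hr
      rw [← ENNReal.ofReal_coe_nnreal] at hr'
      exact (ENNReal.ofReal_lt_ofReal_iff_of_nonneg (by positivity)).1 hr'
    have h2 : ((a : ℝ) ^ 2)⁻¹ < 1 - r ^ 2 := by
      have h3 : (√(1 - r ^ 2))⁻¹ ^ 2 < (a : ℝ) ^ 2 := by gcongr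
      rw [inv_pow, Real.sq_sqrt hpos.le] at h3
      exact inv_lt_of_inv_lt₀ hpos h3
    exact ⟨hr0, Real.lt_sqrt_of_sq_lt (by linarith)⟩
  rcases eq_or_ne a 0 with rfl | ha0
  · simp
  have ha0' : 0 < ((a : ℝ) ^ 2)⁻¹ := by positivity
  refine (lintegral_mono_set hsub).trans ?_
  rcases le_or_gt (1 - ((a : ℝ) ^ 2)⁻¹) 0 with h | h
  · rw [Real.sqrt_eq_zero_of_nonpos h]
    simp
  refine (lintegral_radial_density_le ?_).trans ?_
  · rw [Real.sqrt_lt' one_pos]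
    linarith
  · rw [Real.sq_sqrt h.le, sub_sub_cancel, inv_inv, ENNReal.ofReal_pow (by positivity),
      ENNReal.ofReal_coe_nnreal]

/-- The Möbius invariant measure in polar coordinates. -/
lemma moebiusMeasure_eq_lintegral {R : ℝ} (hR : R ≤ 1) {A : Set ℂ} (hA : MeasurableSet A)
    (hAR : A ⊆ ball 0 R) :
    moebiusMeasure A =
      ∫⁻ θ, radialMeasure R {r | r ∈ Ioo 0 R ∧ circleMap 0 r θ ∈ A} ∂arcMeasure := by
  set D : ℂ → ℝ≥0∞ := fun z => ENNReal.ofReal (1 / (Real.pi * (1 - ‖z‖ ^ 2) ^ 2)) with hD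
  have hDm : Measurable D := by fun_prop
  have h1 : moebiusMeasure A = ∫⁻ z, A.indicator D z := by
    rw [moebiusMeasure, withDensity_apply _ hA, Measure.restrict_restrict hA,
      inter_eq_self_of_subset_left (hAR.trans (ball_subset_ball hR)), lintegral_indicator hA]
  set K : ℝ → ℝ≥0∞ := fun θ =>
    ∫⁻ r in Ioi (0 : ℝ), ENNReal.ofReal r * A.indicator D (circleMap 0 r θ) with hK
  have hKper : Function.Periodic K (2 * Real.pi) := fun θ => by
    simp only [hK, periodic_circleMap 0 _ θ]
  have h2 : ∫⁻ z, A.indicator D z = ∫⁻ θ in Ioo (-Real.pi) Real.pi, K θ := by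
    rw [← Complex.lintegral_comp_polarCoord_symm, polarCoord_target, Measure.volume_eq_prod,
      ← Measure.prod_restrict, lintegral_prod_symm']
    · refine lintegral_congr fun θ => lintegral_congr fun r => ?_
      simp [circleMap, Complex.exp_mul_I, Complex.polarCoord_symm_apply]
    · have : Measurable fun p : ℝ × ℝ => Complex.polarCoord.symm p := by
        simp only [Complex.polarCoord_symm_apply]
        fun_prop
      exact (by fun_prop : Measurable fun p : ℝ × ℝ => ENNReal.ofReal p.1).smul
        ((hDm.indicator hA).comp this)
  have h3 : ∫⁻ θ in Ioo (-Real.pi) Real.pi, K θ = ∫⁻ θ in Ioc 0 (2 * Real.pi), K θ := by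
    rw [setLIntegral_congr Ioo_ae_eq_Ioc]
    -- Polar coordinates use angles in `(-π, π)`, the Hardy norm angles in `(0, 2π]`.
    have e1 := isAddFundamentalDomain_Ioc Real.two_pi_pos (-Real.pi)
    have e2 := isAddFundamentalDomain_Ioc Real.two_pi_pos 0
    rw [show -Real.pi + 2 * Real.pi = Real.pi by ring] at e1
    rw [zero_add] at e2
    refine e1.setLIntegral_eq e2 K fun g x => ?_
    obtain ⟨n, hn⟩ := AddSubgroup.mem_zmultiples_iff.1 g.2
    change K ((g : ℝ) + x) = K x
    rw [← hn, add_comm]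
    exact hKper.zsmul n x
  rw [h1, h2, h3, lintegral_arcMeasure, div_eq_mul_inv,
    ← lintegral_mul_const' _ _ (ENNReal.inv_ne_top.2 ofReal_two_pi_ne_zero)]
  refine lintegral_congr fun θ => ?_
  have hSm : MeasurableSet {r : ℝ | r ∈ Ioo 0 R ∧ circleMap 0 r θ ∈ A} := by
    refine measurableSet_Ioo.inter ?_
    have : Measurable fun r : ℝ => circleMap 0 r θ := by
      unfold circleMap; fun_prop
    exact this hA
  rw [radialMeasure, withDensity_apply _ hSm, Measure.restrict_restrict hSm,
    inter_eq_self_of_subset_left fun r hr => hr.1,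
    ← lintegral_mul_const' _ _ (ENNReal.inv_ne_top.2 ofReal_two_pi_ne_zero)]
  change ∫⁻ r in Ioi (0 : ℝ), ENNReal.ofReal r * A.indicator D (circleMap 0 r θ) = _
  rw [← lintegral_indicator measurableSet_Ioi, ← lintegral_indicator hSm]
  refine lintegral_congr fun r => ?_
  rcases le_or_gt r 0 with hr | hr
  · rw [indicator_of_notMem (by simpa using hr), indicator_of_notMem]
    exact fun h => absurd h.1.1 (not_lt.2 hr)
  rw [indicator_of_mem (by simpa using hr)]
  by_cases hrA : circleMap 0 r θ ∈ A
  · have hrR : r < R := by simpa [abs_of_pos hr] using hAR hrA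
    rw [indicator_of_mem hrA, indicator_of_mem (by exact ⟨⟨hr, hrR⟩, hrA⟩), hD,
      ← ENNReal.ofReal_inv_of_pos Real.two_pi_pos]
    simp only [norm_circleMap_zero, sq_abs]
    rw [← ENNReal.ofReal_mul hr.le, ← ENNReal.ofReal_mul (by positivity)]
    congr 1
    have := Real.pi_ne_zero
    have : 1 - r ^ 2 ≠ 0 := by nlinarith
    field_simp
  · rw [indicator_of_notMem hrA, indicator_of_notMem (fun h => hrA h.2)]
    simp

lemma isOpen_superlevelSet {f : ℂ → ℂ} (hf : ContinuousOn f (ball 0 1)) (t : ℝ) :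
    IsOpen (superlevelSet f t) :=
  ContinuousOn.isOpen_inter_preimage (f := fun z => ‖f z‖ ^ 2 * (1 - ‖z‖ ^ 2)) (by fun_prop)
    isOpen_ball isOpen_Ioi

/-- Weak-type estimate for functions continuous up to the circle, on a compactly contained disc. -/
lemma mul_moebiusMeasure_superlevelSet_inter_ball_le {f : ℂ → ℂ}
    (hf : DiffContOnCl ℂ f (ball 0 1)) {R t : ℝ} (hR : R < 1) (ht : 0 < t) :
    ENNReal.ofReal t * moebiusMeasure (superlevelSet f t ∩ ball 0 R) ≤
      2304 * ∫⁻ φ, ‖f (circleMap 0 1 φ)‖ₑ ^ 2 ∂arcMeasure := by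
  have := isFiniteMeasure_radialMeasure hR
  have hEm : MeasurableSet (superlevelSet f t ∩ ball 0 R) :=
    (isOpen_superlevelSet hf.differentiableOn.continuousOn t).measurableSet.inter
      measurableSet_ball
  have hcm : Measurable fun x : ℝ × ℝ => circleMap 0 x.1 x.2 := by
    unfold circleMap; fun_prop
  rw [moebiusMeasure_eq_lintegral hR.le hEm inter_subset_right]
  set A : Set (ℝ × ℝ) :=
    {x | x.1 ∈ Ioo 0 R ∧ circleMap 0 x.1 x.2 ∈ superlevelSet f t ∩ ball 0 R} with hA
  have hAm : MeasurableSet A := (measurable_fst measurableSet_Ioo).inter (hcm hEm)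
  have hs2 : ENNReal.ofReal t = ENNReal.ofReal (√t) ^ 2 := by
    rw [← ENNReal.ofReal_pow (Real.sqrt_nonneg t), Real.sq_sqrt ht.le]
  rw [hs2]
  have key := mul_prod_le_of_le_superposition (ν := radialMeasure R) (τ := arcMeasure)
    (P := fun x φ => ENNReal.ofReal (poissonKernel 0 (circleMap 0 x.1 x.2) (circleMap 0 1 φ)))
    (B := ENNReal.ofReal (1 / (1 - R) ^ 2)) (C := 8) (A := A)
    (g := fun r => ENNReal.ofReal (√(1 - r ^ 2))⁻¹)
    (F := fun φ => ‖f (circleMap 0 1 φ)‖ₑ) (s := ENNReal.ofReal (√t))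
    ?_ hAm ENNReal.ofReal_ne_top ?_ ?_ (by fun_prop) (radialMeasure_inv_sqrt_lt_le hR.le)
    (continuous_comp_circleMap hf).measurable.enorm ?_
  · refine key.trans (le_of_eq ?_)
    norm_num
  · simp only [poissonKernel_def]
    unfold circleMap
    fun_prop
  · rintro ⟨r, θ⟩ ⟨⟨hr0, hrR⟩, -⟩ φ
    refine ENNReal.ofReal_le_ofReal ?_
    simp only at hr0 hrR ⊢
    rw [poissonKernel_def, sub_zero, sub_zero, norm_circleMap_zero, norm_circleMap_zero,
      abs_of_pos hr0, abs_one]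
    have h1 := norm_sub_norm_le (circleMap 0 1 φ) (circleMap 0 r θ)
    rw [norm_circleMap_zero, norm_circleMap_zero, abs_of_pos hr0, abs_one] at h1
    have h2 : 0 < 1 - R := by linarith
    gcongr
    · nlinarith
    · linarith
  · rintro ⟨r, θ⟩ ⟨⟨hr0, hrR⟩, -⟩ ⟨s, φ⟩ ⟨⟨hs0, hsR⟩, -⟩
    exact lintegral_poissonKernel_mul_le hr0.le (hrR.trans hR) hs0.le (hsR.trans hR) θ φ
  · rintro ⟨r, θ⟩ ⟨⟨hr0, hrR⟩, ⟨hz, hzt⟩, -⟩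
    simp only at hr0 hrR hz hzt ⊢
    refine le_trans ?_ (enorm_le_lintegral_poissonKernel hf (by simpa using hz))
    rw [norm_circleMap_zero, sq_abs] at hzt
    have hpos : 0 < 1 - r ^ 2 := by nlinarith
    rw [← ENNReal.ofReal_mul (Real.sqrt_nonneg t), ← ofReal_norm]
    refine ENNReal.ofReal_le_ofReal ?_
    rw [← div_eq_mul_inv, div_le_iff₀ (Real.sqrt_pos.2 hpos)]
    refine Real.sqrt_le_iff.2 ⟨by positivity, ?_⟩
    rw [mul_pow, Real.sq_sqrt hpos.le]
    exact hzt.le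

/-! ### Szegő kernels and two points of a superlevel set -/

/-- The Szegő kernel `ζ ↦ (1 - w̄ ζ)⁻¹` reproduces the value at `w`. -/
lemma integral_mul_conj_szegoKernel {f : ℂ → ℂ} (hf : DiffContOnCl ℂ f (ball 0 1)) {w : ℂ}
    (hw : ‖w‖ < 1) :
    ∫ φ, f (circleMap 0 1 φ) *
      (starRingEnd ℂ) (1 - (starRingEnd ℂ) w * circleMap 0 1 φ)⁻¹ ∂arcMeasure = f w := by
  have h := DiffContOnCl.circleAverage_smul_div (c := 0) (R := 1) (f := f) (w := w)
    (by simpa using hf) (by simpa using hw)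
  rw [circleAverage_eq_integral_arcMeasure] at h
  rw [← h]
  refine integral_congr_ae (.of_forall fun φ => ?_)
  have hζ : circleMap 0 1 φ * (starRingEnd ℂ) (circleMap 0 1 φ) = 1 := by
    rw [Complex.mul_conj, Complex.normSq_eq_norm_sq]; simp
  have hζ0 : circleMap 0 1 φ ≠ 0 := left_ne_zero_of_mul_eq_one hζ
  simp only [map_inv₀, map_sub, map_mul, map_one, Complex.conj_conj, sub_zero, smul_eq_mul]
  rw [mul_comm]
  congr 1
  have h1 : circleMap 0 1 φ - w =
      circleMap 0 1 φ * (1 - w * (starRingEnd ℂ) (circleMap 0 1 φ)) := by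
    linear_combination w * hζ
  rw [h1, div_mul_cancel_left₀ hζ0]

/-- Cauchy–Schwarz for a combination of two Szegő kernels; the right side bounds its squared
norm. -/
lemma norm_sq_add_le {f : ℂ → ℂ} (hf : DiffContOnCl ℂ f (ball 0 1))
    (hf1 : ∫⁻ φ, ‖f (circleMap 0 1 φ)‖ₑ ^ 2 ∂arcMeasure ≤ 1) {z w : ℂ} (hz : ‖z‖ < 1)
    (hw : ‖w‖ < 1) (α β : ℂ) :
    ‖α * f z + β * f w‖ ^ 2 ≤ ‖α‖ ^ 2 / (1 - ‖z‖ ^ 2) + ‖β‖ ^ 2 / (1 - ‖w‖ ^ 2) +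
      2 * (‖α‖ * ‖β‖ / ‖1 - (starRingEnd ℂ) z * w‖) := by
  set G : ℂ → ℂ := fun u => (starRingEnd ℂ) α * (1 - (starRingEnd ℂ) z * u)⁻¹ +
    (starRingEnd ℂ) β * (1 - (starRingEnd ℂ) w * u)⁻¹ with hG
  have hK : ∀ {u : ℂ}, ‖u‖ < 1 → DiffContOnCl ℂ (fun v => (1 - (starRingEnd ℂ) u * v)⁻¹)
      (ball 0 1) := fun {u} hu => by
      apply DifferentiableOn.diffContOnCl
      rw [closure_ball _ one_ne_zero]
      intro v hv
      have := one_sub_conj_mul_ne_zero hu (mem_closedBall_zero_iff.1 hv)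
      apply DifferentiableAt.differentiableWithinAt
      fun_prop (disch := assumption)
  have hGd : DiffContOnCl ℂ G (ball 0 1) :=
    ((hK hz).const_smul ((starRingEnd ℂ) α)).add ((hK hw).const_smul ((starRingEnd ℂ) β))
  have hint : ∀ {k : ℝ → ℂ}, Continuous k → Integrable k arcMeasure := fun {k} hk =>
    hk.integrableOn_Ioc.smul_measure (ENNReal.inv_ne_top.2 ofReal_two_pi_ne_zero)
  have hrep : ∀ {h : ℂ → ℂ}, DiffContOnCl ℂ h (ball 0 1) →
      ∫ φ, h (circleMap 0 1 φ) * (starRingEnd ℂ) (G (circleMap 0 1 φ)) ∂arcMeasure =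
        α * h z + β * h w := fun {h} hh => by
    have hc : ∀ {u : ℂ}, ‖u‖ < 1 → Continuous fun φ => h (circleMap 0 1 φ) *
        (starRingEnd ℂ) (1 - (starRingEnd ℂ) u * circleMap 0 1 φ)⁻¹ := fun {u} hu =>
      (continuous_comp_circleMap hh).mul
        (Complex.continuous_conj.comp (continuous_comp_circleMap (hK hu)))
    rw [← integral_mul_conj_szegoKernel hh hz, ← integral_mul_conj_szegoKernel hh hw,
      ← integral_const_mul, ← integral_const_mul,
      ← integral_add ((hint (hc hz)).const_mul α) ((hint (hc hw)).const_mul β)]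
    refine integral_congr_ae (.of_forall fun φ => ?_)
    simp only [hG, map_add, map_mul, Complex.conj_conj]
    ring
  have hGG : ∫⁻ φ, ‖G (circleMap 0 1 φ)‖ₑ ^ 2 ∂arcMeasure = ‖α * G z + β * G w‖ₑ := by
    have hGc := continuous_comp_circleMap hGd
    have h1 : ∫ φ, G (circleMap 0 1 φ) * (starRingEnd ℂ) (G (circleMap 0 1 φ)) ∂arcMeasure =
        ((∫ φ, ‖G (circleMap 0 1 φ)‖ ^ 2 ∂arcMeasure : ℝ) : ℂ) := by
      rw [← integral_complex_ofReal]
      refine integral_congr_ae (.of_forall fun φ => ?_)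
      simp only
      rw [Complex.mul_conj, Complex.normSq_eq_norm_sq]
    rw [← hrep hGd, h1, ← ofReal_norm, Complex.norm_real,
      Real.norm_of_nonneg (integral_nonneg fun φ => by positivity),
      ofReal_integral_eq_lintegral_ofReal]
    · refine lintegral_congr fun φ => ?_
      rw [ENNReal.ofReal_pow (norm_nonneg _), ofReal_norm]
    · exact ((hGc.norm.pow 2).integrableOn_Ioc).smul_measure
        (ENNReal.inv_ne_top.2 ofReal_two_pi_ne_zero)
    · exact .of_forall fun φ => by positivity
  have hCS : ‖α * f z + β * f w‖ₑ ^ 2 ≤ ‖α * G z + β * G w‖ₑ := by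
    calc ‖α * f z + β * f w‖ₑ ^ 2 ≤
        (∫⁻ φ, ‖f (circleMap 0 1 φ)‖ₑ * ‖G (circleMap 0 1 φ)‖ₑ ∂arcMeasure) ^ 2 := by
          rw [← hrep hf]
          gcongr
          refine (enorm_integral_le_lintegral_enorm _).trans_eq (lintegral_congr fun φ => ?_)
          rw [enorm_mul, RCLike.enorm_conj]
      _ ≤ _ := sq_lintegral_mul_le _ (continuous_comp_circleMap hf).measurable.enorm
          (continuous_comp_circleMap hGd).measurable.enorm
      _ ≤ 1 * _ := by gcongr
      _ = _ := by rw [one_mul, hGG]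
  have hCS' : ‖α * f z + β * f w‖ ^ 2 ≤ ‖α * G z + β * G w‖ := by
    rw [← ofReal_norm, ← ofReal_norm, ← ENNReal.ofReal_pow (norm_nonneg _)] at hCS
    exact (ENNReal.ofReal_le_ofReal_iff (norm_nonneg _)).1 hCS
  refine hCS'.trans ?_
  have hdiag : ∀ {u : ℂ}, ‖u‖ < 1 → ‖1 - (starRingEnd ℂ) u * u‖ = 1 - ‖u‖ ^ 2 := fun {u} hu => by
    rw [mul_comm, Complex.mul_conj, Complex.normSq_eq_norm_sq, ← Complex.ofReal_one,
      ← Complex.ofReal_sub, Complex.norm_real, Real.norm_of_nonneg]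
    nlinarith [norm_nonneg u]
  have hsymm : ‖1 - (starRingEnd ℂ) w * z‖ = ‖1 - (starRingEnd ℂ) z * w‖ := by
    rw [← RCLike.norm_conj]
    simp [mul_comm]
  calc ‖α * G z + β * G w‖ = ‖α * (starRingEnd ℂ) α * (1 - (starRingEnd ℂ) z * z)⁻¹ +
        α * (starRingEnd ℂ) β * (1 - (starRingEnd ℂ) w * z)⁻¹ +
        β * (starRingEnd ℂ) α * (1 - (starRingEnd ℂ) z * w)⁻¹ +
        β * (starRingEnd ℂ) β * (1 - (starRingEnd ℂ) w * w)⁻¹‖ := by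
          congr 1
          simp only [hG]
          ring
    _ ≤ _ := norm_add₄_le
    _ = _ := by
      simp only [norm_mul, norm_inv, RCLike.norm_conj, hdiag hz, hdiag hw, hsymm]
      ring

/-- If `f` almost attains the pointwise bound `|f|² (1 - |z|²) ≤ 1` at `z` and at `w`, then the
normalized Szegő kernels at `z` and `w` are almost parallel. -/
lemma mul_norm_le_of_mem_superlevelSet {f : ℂ → ℂ} (hf : DiffContOnCl ℂ f (ball 0 1))
    (hf1 : ∫⁻ φ, ‖f (circleMap 0 1 φ)‖ₑ ^ 2 ∂arcMeasure ≤ 1) {t : ℝ} (ht : 0 < t) {z w : ℂ}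
    (hz : z ∈ superlevelSet f t) (hw : w ∈ superlevelSet f t) :
    (2 * t - 1) * ‖1 - (starRingEnd ℂ) z * w‖ ≤ √(1 - ‖z‖ ^ 2) * √(1 - ‖w‖ ^ 2) := by
  have hz1 : ‖z‖ < 1 := by simpa using hz.1
  have hw1 : ‖w‖ < 1 := by simpa using hw.1
  have hsz : 0 < 1 - ‖z‖ ^ 2 := by nlinarith [norm_nonneg z]
  have hsw : 0 < 1 - ‖w‖ ^ 2 := by nlinarith [norm_nonneg w]
  -- Rotating both values to the positive axis makes them add up without cancellation.
  have hphase : ∀ u : ℂ, ∃ c : ℂ, ‖c‖ = 1 ∧ c * u = ‖u‖ := fun u => by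
    rcases eq_or_ne u 0 with rfl | hu
    · exact ⟨1, by simp⟩
    · refine ⟨‖u‖ / u, ?_, div_mul_cancel₀ _ hu⟩
      rw [norm_div, Complex.norm_real, norm_norm, div_self (norm_ne_zero_iff.2 hu)]
  obtain ⟨c, hc, hcz⟩ := hphase (f z)
  obtain ⟨d, hd, hdw⟩ := hphase (f w)
  set a := √(1 - ‖z‖ ^ 2) with ha
  set b := √(1 - ‖w‖ ^ 2) with hb
  have ha2 : a ^ 2 = 1 - ‖z‖ ^ 2 := Real.sq_sqrt hsz.le
  have hb2 : b ^ 2 = 1 - ‖w‖ ^ 2 := Real.sq_sqrt hsw.le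
  have ha0 : 0 ≤ a := Real.sqrt_nonneg _
  have hb0 : 0 ≤ b := Real.sqrt_nonneg _
  have h := norm_sq_add_le hf hf1 hz1 hw1 (a * c) (b * d)
  have e1 : (a * c) * f z + (b * d) * f w = ((a * ‖f z‖ + b * ‖f w‖ : ℝ) : ℂ) := by
    push_cast
    rw [← hcz, ← hdw]
    ring
  rw [e1, Complex.norm_real, Real.norm_of_nonneg (by positivity), norm_mul, norm_mul, hc, hd,
    Complex.norm_real, Complex.norm_real, Real.norm_of_nonneg ha0, Real.norm_of_nonneg hb0,
    mul_one, mul_one, ← ha2, ← hb2] at h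
  rw [div_self (by rw [ha2]; exact hsz.ne'), div_self (by rw [hb2]; exact hsw.ne')] at h
  have hx : √t ≤ a * ‖f z‖ := Real.sqrt_le_iff.2 ⟨by positivity, by
    rw [mul_pow, ha2, mul_comm]; exact hz.2.le⟩
  have hy : √t ≤ b * ‖f w‖ := Real.sqrt_le_iff.2 ⟨by positivity, by
    rw [mul_pow, hb2, mul_comm]; exact hw.2.le⟩
  have h4 : 4 * t ≤ (a * ‖f z‖ + b * ‖f w‖) ^ 2 := by
    calc 4 * t = (√t + √t) ^ 2 := by rw [← two_mul, mul_pow, Real.sq_sqrt ht.le]; norm_num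
      _ ≤ _ := by gcongr
  have hk : 0 < ‖1 - (starRingEnd ℂ) z * w‖ :=
    norm_pos_iff.2 (one_sub_conj_mul_ne_zero hz1 hw1.le)
  rw [← le_div_iff₀ hk]
  linarith

lemma norm_sq_one_sub_conj_mul (z w : ℂ) :
    ‖1 - (starRingEnd ℂ) z * w‖ ^ 2 = (1 - ‖z‖ ^ 2) * (1 - ‖w‖ ^ 2) + ‖w - z‖ ^ 2 := by
  simp only [← Complex.normSq_eq_norm_sq, Complex.normSq_apply, Complex.sub_re, Complex.sub_im,
    Complex.mul_re, Complex.mul_im, Complex.conj_re, Complex.conj_im, Complex.one_re,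
    Complex.one_im]
  ring

/-- A small pseudo-hyperbolic disc about `z` lies in a Euclidean disc of radius comparable to
`√ε (1 - |z|²)`, on which `1 - |w|²` is bounded below by a multiple of `1 - |z|²`. -/
lemma norm_sub_le_and_le_one_sub_norm_sq {z w : ℂ} (hz : ‖z‖ < 1) (hw : ‖w‖ < 1) {ε : ℝ}
    (hε0 : 0 ≤ ε) (hε : ε ≤ 1 / 16)
    (h : (1 - 4 * ε) * ‖1 - (starRingEnd ℂ) z * w‖ ^ 2 ≤ (1 - ‖z‖ ^ 2) * (1 - ‖w‖ ^ 2)) :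
    ‖w - z‖ ≤ 4 * √ε * (1 - ‖z‖ ^ 2) ∧ 3 / 16 * (1 - ‖z‖ ^ 2) ≤ 1 - ‖w‖ ^ 2 := by
  have hid := norm_sq_one_sub_conj_mul z w
  have hz0 := norm_nonneg z
  have hw0 := norm_nonneg w
  set N := ‖1 - (starRingEnd ℂ) z * w‖ with hN
  have hN0 : 0 ≤ N := norm_nonneg _
  set d := ‖w - z‖ with hd
  have hd0 : 0 ≤ d := norm_nonneg _
  set s := 1 - ‖z‖ ^ 2 with hs
  have hs0 : 0 < s := by nlinarith
  have he2 : √ε ^ 2 = ε := Real.sq_sqrt hε0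
  have he0 : 0 ≤ √ε := Real.sqrt_nonneg _
  have he4 : √ε ≤ 1 / 4 := Real.sqrt_le_iff.2 ⟨by norm_num, by linarith⟩
  -- By `norm_sq_one_sub_conj_mul`, the hypothesis says `d² ≤ 4 ε N²`.
  have hdN : d ≤ 2 * √ε * N := by
    refine abs_le_of_sq_le_sq' ?_ (by positivity) |>.2
    rw [mul_pow, mul_pow, he2]
    linarith
  have hNle : N ≤ s + d := by
    calc N = ‖(1 - (starRingEnd ℂ) z * z) - (starRingEnd ℂ) z * (w - z)‖ := by
          rw [hN]; congr 1; ring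
      _ ≤ ‖1 - (starRingEnd ℂ) z * z‖ + ‖(starRingEnd ℂ) z * (w - z)‖ := norm_sub_le _ _
      _ ≤ s + d := by
        have h1 : ‖1 - (starRingEnd ℂ) z * z‖ = s := by
          rw [mul_comm, Complex.mul_conj, Complex.normSq_eq_norm_sq, ← Complex.ofReal_one,
            ← Complex.ofReal_sub, Complex.norm_real, Real.norm_of_nonneg hs0.le]
        rw [h1, norm_mul, RCLike.norm_conj]
        gcongr
        exact mul_le_of_le_one_left hd0 hz.le
  have hNs : N ≤ 2 * s := by nlinarith
  constructor
  · nlinarith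
  · have hlow : s / 2 ≤ N := by
      have h1 := norm_sub_norm_le (1 : ℂ) ((starRingEnd ℂ) z * w)
      rw [norm_one, norm_mul, RCLike.norm_conj] at h1
      have : ‖z‖ * ‖w‖ ≤ ‖z‖ := mul_le_of_le_one_right hz0 hw.le
      nlinarith
    have h2 : s ^ 2 / 4 ≤ N ^ 2 := by nlinarith
    have h3 : 3 / 4 * N ^ 2 ≤ s * (1 - ‖w‖ ^ 2) := by nlinarith [sq_nonneg N]
    refine le_of_mul_le_mul_left ?_ hs0
    nlinarith

lemma diffContOnCl_dilation {f : ℂ → ℂ} (hf : DifferentiableOn ℂ f (ball 0 1)) {ρ : ℝ}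
    (hρ : ρ ∈ Ioo (0 : ℝ) 1) : DiffContOnCl ℂ (fun z => f (ρ * z)) (ball 0 1) := by
  apply DifferentiableOn.diffContOnCl
  rw [closure_ball _ one_ne_zero]
  refine hf.comp (by fun_prop) fun z hz => ?_
  rw [mem_closedBall_zero_iff] at hz
  rw [mem_ball_zero_iff, norm_mul, Complex.norm_real, Real.norm_of_nonneg hρ.1.le]
  nlinarith [hρ.1, hρ.2, norm_nonneg z]

lemma lintegral_dilation_le_one {f : ℂ → ℂ} (hf : hardyNorm 2 f ≤ 1) {ρ : ℝ}
    (hρ : ρ ∈ Ioo (0 : ℝ) 1) :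
    ∫⁻ φ, ‖f (ρ * circleMap 0 1 φ)‖ₑ ^ 2 ∂arcMeasure ≤ 1 := by
  have h : integralMean 2 f ρ ≤ 1 := (le_iSup₂ (f := fun r (_ : r ∈ Ioo (0 : ℝ) 1) =>
    integralMean 2 f r) ρ hρ).trans hf
  rw [integralMean] at h
  have h2 := pow_le_pow_left' h 2
  rw [rpow_half_sq, one_pow] at h2
  rw [lintegral_arcMeasure]
  refine le_of_eq_of_le ?_ h2
  congr 1
  refine lintegral_congr fun φ => ?_
  simp [circleMap]

/-- Each point of the superlevel set of `f` belongs to those of the dilations `f(u ·)` for `u` near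
`1`. -/
lemma eventually_mem_superlevelSet_dilation {f : ℂ → ℂ} (hf : DifferentiableOn ℂ f (ball 0 1))
    {u : ℕ → ℝ} (hu : Tendsto u atTop (𝓝 1)) {t : ℝ} {z : ℂ} (hz : z ∈ superlevelSet f t) :
    ∀ᶠ n in atTop, z ∈ superlevelSet (fun z => f (u n * z)) t := by
  have hfc : ContinuousAt f z := hf.continuousOn.continuousAt (isOpen_ball.mem_nhds hz.1)
  have h1 : Tendsto (fun n => (u n : ℂ) * z) atTop (𝓝 z) := by
    have := ((Complex.continuous_ofReal.tendsto 1).comp hu).mul_const z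
    simpa using this
  have h2 := (((hfc.tendsto.comp h1).norm.pow 2).mul_const (1 - ‖z‖ ^ 2)).eventually_const_lt hz.2
  exact h2.mono fun n hn => ⟨hz.1, hn⟩

lemma mul_moebiusMeasure_superlevelSet_le {f : ℂ → ℂ} (hf : DifferentiableOn ℂ f (ball 0 1))
    (hf1 : hardyNorm 2 f ≤ 1) {t : ℝ} (ht : 0 < t) :
    ENNReal.ofReal t * moebiusMeasure (superlevelSet f t) ≤ 2304 := by
  obtain ⟨u, -, hu, hu1⟩ := exists_seq_strictMono_tendsto' (zero_lt_one (α := ℝ))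
  set A : ℕ → Set ℂ := fun n => superlevelSet (fun z => f (u n * z)) t ∩ ball 0 (u n) with hA
  have hAle : ∀ n, ENNReal.ofReal t * moebiusMeasure (A n) ≤ 2304 := fun n => by
    refine (mul_moebiusMeasure_superlevelSet_inter_ball_le (diffContOnCl_dilation hf (hu n))
      (hu n).2 ht).trans ?_
    calc _ ≤ 2304 * (1 : ℝ≥0∞) := by gcongr; exact lintegral_dilation_le_one hf1 (hu n)
      _ = 2304 := mul_one _
  -- The superlevel set is contained in the lower limit of the sets `A n`.
  set S : ℕ → Set ℂ := fun n => ⋂ m ≥ n, A m with hS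
  have hSmono : Monotone S := fun n k hnk =>
    biInter_subset_biInter_left fun m hm => le_trans hnk hm
  have hsub : superlevelSet f t ⊆ ⋃ n, S n := fun z hz => by
    have h1 := eventually_mem_superlevelSet_dilation hf hu1 hz
    have h2 : ∀ᶠ n in atTop, ‖z‖ < u n := hu1.eventually_const_lt (by simpa using hz.1)
    obtain ⟨n, hn⟩ := eventually_atTop.1 (h1.and h2)
    exact mem_iUnion.2 ⟨n, mem_iInter₂.2 fun m hm => ⟨(hn m hm).1, by simpa using (hn m hm).2⟩⟩
  calc _ ≤ ENNReal.ofReal t * moebiusMeasure (⋃ n, S n) := by gcongr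
    _ = ⨆ n, ENNReal.ofReal t * moebiusMeasure (S n) := by
      rw [hSmono.measure_iUnion, ENNReal.mul_iSup]
    _ ≤ 2304 := iSup_le fun n => le_trans
      (by gcongr; exact iInter₂_subset n le_rfl) (hAle n)

/-- For `t` near `1`, any point `z` of the superlevel set has the whole set in a small disc about
it, on which the density of the measure is comparable to its value at `z`. -/
lemma moebiusMeasure_superlevelSet_le_of_near_one {f : ℂ → ℂ}
    (hf : DifferentiableOn ℂ f (ball 0 1)) (hf1 : hardyNorm 2 f ≤ 1) {t : ℝ} (ht : 15 / 16 ≤ t)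
    (ht1 : t < 1) :
    moebiusMeasure (superlevelSet f t) ≤ ENNReal.ofReal (4096 / 9 * (1 - t)) := by
  rcases (superlevelSet f t).eq_empty_or_nonempty with h0 | ⟨z, hz⟩
  · rw [h0]; simp
  have hz1 : ‖z‖ < 1 := by simpa using hz.1
  set s := 1 - ‖z‖ ^ 2 with hs
  have hs0 : 0 < s := by nlinarith [norm_nonneg z]
  have hgeom : ∀ w ∈ superlevelSet f t,
      ‖w - z‖ ≤ 4 * √(1 - t) * s ∧ 3 / 16 * s ≤ 1 - ‖w‖ ^ 2 := fun w hw => by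
    have hw1 : ‖w‖ < 1 := by simpa using hw.1
    refine norm_sub_le_and_le_one_sub_norm_sq hz1 hw1 (by linarith) (by linarith) ?_
    obtain ⟨u, -, hu, hu1⟩ := exists_seq_strictMono_tendsto' (zero_lt_one (α := ℝ))
    obtain ⟨n, hnz, hnw⟩ := ((eventually_mem_superlevelSet_dilation hf hu1 hz).and
      (eventually_mem_superlevelSet_dilation hf hu1 hw)).exists
    have h := mul_norm_le_of_mem_superlevelSet (diffContOnCl_dilation hf (hu n))
      (lintegral_dilation_le_one hf1 (hu n)) (by linarith) hnz hnw
    have h2 := pow_le_pow_left₀ (mul_nonneg (by linarith) (norm_nonneg _)) h 2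
    rw [mul_pow, mul_pow, Real.sq_sqrt hs0.le,
      Real.sq_sqrt (by nlinarith [norm_nonneg w])] at h2
    refine le_trans ?_ h2
    gcongr
    nlinarith [sq_nonneg (1 - t)]
  have hEm : MeasurableSet (superlevelSet f t) :=
    (isOpen_superlevelSet hf.continuousOn t).measurableSet
  have hEb : superlevelSet f t ⊆ ball 0 1 := fun w hw => hw.1
  have hEc : superlevelSet f t ⊆ closedBall z (4 * √(1 - t) * s) := fun w hw =>
    mem_closedBall_iff_norm.2 (hgeom w hw).1
  calc moebiusMeasure (superlevelSet f t)
      = ∫⁻ w in superlevelSet f t, ENNReal.ofReal (1 / (Real.pi * (1 - ‖w‖ ^ 2) ^ 2)) := by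
        rw [moebiusMeasure, withDensity_apply _ hEm, Measure.restrict_restrict hEm,
          inter_eq_self_of_subset_left hEb]
    _ ≤ ∫⁻ _ in superlevelSet f t, ENNReal.ofReal (1 / (Real.pi * (3 / 16 * s) ^ 2)) := by
        refine setLIntegral_mono' hEm fun w hw => ENNReal.ofReal_le_ofReal ?_
        have := (hgeom w hw).2
        have := Real.pi_pos
        gcongr
    _ = ENNReal.ofReal (1 / (Real.pi * (3 / 16 * s) ^ 2)) * volume (superlevelSet f t) :=
        setLIntegral_const _ _
    _ ≤ ENNReal.ofReal (1 / (Real.pi * (3 / 16 * s) ^ 2)) *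
          volume (closedBall z (4 * √(1 - t) * s)) := by gcongr
    _ = ENNReal.ofReal (4096 / 9 * (1 - t)) := by
        have hpi : (NNReal.pi : ℝ≥0∞) = ENNReal.ofReal Real.pi := by
          rw [← NNReal.coe_real_pi, ENNReal.ofReal_coe_nnreal]
        rw [Complex.volume_closedBall, hpi, ← ENNReal.ofReal_pow (by positivity),
          ← ENNReal.ofReal_mul (by positivity), ← ENNReal.ofReal_mul (by positivity)]
        congr 1
        have := Real.pi_ne_zero
        have h2 : √(1 - t) ^ 2 = 1 - t := Real.sq_sqrt (by linarith)
        rw [mul_pow, mul_pow, mul_pow, h2]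
        field_simp
        norm_num
        ring

end HardyDisc

end

theorem theorem3p1 :
    ∃ C : ℝ, 0 < C ∧
      ∀ f : ℂ → ℂ, HardyDisc.MemHardy 2 f → HardyDisc.hardyNorm 2 f = 1 →
        ∀ t : ℝ, 0 < t → t < 1 →
          HardyDisc.moebiusMeasure (HardyDisc.superlevelSet f t) ≤
            ENNReal.ofReal (C * (1 / t - 1)) := by
  -- `36864 = 16 * 2304`: for `t < 15 / 16` the factor `1 - t` is at least `1 / 16`.
  refine ⟨36864, by norm_num, fun f hf hf1 t ht ht1 => ?_⟩
  have hid : 1 / t - 1 = (1 - t) / t := by field_simp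
  rw [hid]
  rcases le_or_gt (15 / 16) t with h | h
  · refine (HardyDisc.moebiusMeasure_superlevelSet_le_of_near_one hf.1 hf1.le h ht1).trans
      (ENNReal.ofReal_le_ofReal ?_)
    have : 1 - t ≤ (1 - t) / t := le_div_self (by linarith) ht ht1.le
    linarith
  · have hw := HardyDisc.mul_moebiusMeasure_superlevelSet_le hf.1 hf1.le ht
    have hle : HardyDisc.moebiusMeasure (HardyDisc.superlevelSet f t) ≤
        2304 / ENNReal.ofReal t := by
      rw [ENNReal.le_div_iff_mul_le (Or.inl (by simpa using ht)) (Or.inl ENNReal.ofReal_ne_top),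
        mul_comm]
      exact hw
    refine hle.trans ?_
    rw [← ENNReal.ofReal_ofNat, ← ENNReal.ofReal_div_of_pos ht]
    refine ENNReal.ofReal_le_ofReal ?_
    rw [← mul_div_assoc]
    gcongr
    linarith
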